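/- Let $\mathbb T=\{z\in\mathbb C:|z|=1\}$ and, for $a\in\mathbb R$, let $R_a:\mathbb T\to\mathbb T$ be the rotation $R_a z=e^{2\pi\imath a}z$. For $\alpha\in\mathbb R$ let $\mathbb A_\alpha$ be the noncommutative $2$-torus, i.e. the universal unital $C^*$-algebra generated by two unitaries $U,V$ subject to $UV=e^{2\pi\imath\alpha}VU$. Let $\theta\in\mathbb R$ with $\theta/2\pi$ irrational, let $f:\mathbb T\to\mathbb T$ be continuous, and let $\Phi_{\theta,f}$ be the Anzai skew-product, i.e. the unique $*$-automorphism of $\mathbb A_\alpha$ with $$\Phi_{\theta,f}(U)=e^{\imath\theta}U,\qquad \Phi_{\theta,f}(V)=f(U)V,$$ where $f(U)$ is given by the continuous functional calculus. For $n\in\mathbb Z$ define $f_n:\mathbb T\to\mathbb T$ by $f_n:=\prod_{l=0}^{n-1}f\circ R_{-l\alpha}$ for $n>0$, $f_0:=1$, and $f_n:=\prod_{l=1}^{|n|}\overline{f\circ R_{l\alpha}}$ for $n<0$. Then the fixed-point subalgebra $(\mathbb A_\alpha)^{\Phi_{\theta,f}}=\{a\in\mathbb A_\alpha : \Phi_{\theta,f}(a)=a\}$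 equals $\mathbb C\,1_{\mathbb A_\alpha}$ (that is, the system $(\mathbb A_\alpha,\Phi_{\theta,f})$ is topologically ergodic) if and only if, for every $n\in\mathbb Z\smallsetminus\{0\}$, the equation $$(g\circ R_{\theta/2\pi})\,f_n=g$$ has no non-zero solution $g\in C(\mathbb T)$. -/

import Mathlib

open scoped ENNReal ComplexConjugate

noncomputable section

namespace NCTorus

/-! ### Functions of a unitary -/

/-- The continuous function `C(𝕋, 𝕋)` regarded as a complex valued one. -/
def toComplex (f : C(Circle, Circle)) : C(Circle, ℂ) :=
  ⟨fun z => (f z : ℂ), continuous_subtype_val.comp f.continuous⟩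

/-- `h(u)` for `h ∈ C(𝕋)` and `u` a unitary of a C⋆-algebra, by the continuous functional calculus.
The functional calculus of Mathlib takes a function on `ℂ` and only looks at its values on the
spectrum of `u`, which is contained in `𝕋`; so the (zero) extension off `𝕋` plays no role. -/
def funOf {B : Type*} [CStarAlgebra B] (h : C(Circle, ℂ)) (u : B) : B :=
  cfc (Function.extend (fun z : Circle => (z : ℂ)) h 0) u

/-- The rotation `R_a z = e^{2πia} z` of the circle. -/
def rot (a : ℝ) (z : Circle) : Circle := Circle.exp (2 * Real.pi * a) * z

theorem extend_coe (h : C(Circle, ℂ)) (z : Circle) :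
    Function.extend (fun z : Circle => (z : ℂ)) h 0 (z : ℂ) = h z :=
  Circle.coe_injective.extend_apply (f := fun z : Circle => (z : ℂ)) h 0 z

theorem mem_circle_of_spectrum {B : Type*} [CStarAlgebra B] {u : B} (hu : u ∈ unitary B)
    {z : ℂ} (hz : z ∈ spectrum ℂ u) : ∃ w : Circle, (w : ℂ) = z := by
  have h := spectrum.subset_circle_of_unitary hu hz
  rw [mem_sphere_zero_iff_norm] at h
  exact ⟨⟨z, mem_sphere_zero_iff_norm.2 h⟩, rfl⟩

theorem continuousOn_extend (h : C(Circle, ℂ)) :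
    ContinuousOn (Function.extend (fun z : Circle => (z : ℂ)) h 0) (Metric.sphere (0 : ℂ) 1) := by
  rw [continuousOn_iff_continuous_domRestrict]
  refine (h.continuous.comp (f := fun z : Metric.sphere (0 : ℂ) 1 => (⟨z.1, by
    have := z.2; rw [mem_sphere_zero_iff_norm] at this
    exact mem_sphere_zero_iff_norm.2 this⟩ : Circle)) ?_).congr ?_
  · exact Continuous.subtype_mk continuous_subtype_val _
  · intro z
    exact (extend_coe h ⟨z.1, _⟩).symm

theorem continuousOn_spectrum {B : Type*} [CStarAlgebra B] (h : C(Circle, ℂ)) {u : B}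
    (hu : u ∈ unitary B) :
    ContinuousOn (Function.extend (fun z : Circle => (z : ℂ)) h 0) (spectrum ℂ u) :=
  (continuousOn_extend h).mono (spectrum.subset_circle_of_unitary hu)

theorem isStarNormal_of_unitary {B : Type*} [CStarAlgebra B] {u : B} (hu : u ∈ unitary B) :
    IsStarNormal u :=
  ⟨by rw [Commute, SemiconjBy, Unitary.star_mul_self_of_mem hu, Unitary.mul_star_self_of_mem hu]⟩

theorem continuous_hom {A B : Type*} [CStarAlgebra A] [CStarAlgebra B] (φ : A →⋆ₐ[ℂ] B) :
    Continuous φ :=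
  AddMonoidHomClass.continuous_of_bound φ 1 fun x => by
    rw [one_mul]
    exact NonUnitalStarAlgHom.norm_apply_le φ x

theorem map_funOf {A B : Type*} [CStarAlgebra A] [CStarAlgebra B] (φ : A →⋆ₐ[ℂ] B)
    (h : C(Circle, ℂ)) {u : A} (hu : u ∈ unitary A) : φ (funOf h u) = funOf h (φ u) := by
  have hφu : φ u ∈ unitary B := Unitary.map_mem φ hu
  exact StarAlgHomClass.map_cfc φ _ u (continuousOn_spectrum h hu) (continuous_hom φ)
    (isStarNormal_of_unitary hu) (isStarNormal_of_unitary hφu)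

theorem funOf_mem_unitary {B : Type*} [CStarAlgebra B] (f : C(Circle, Circle)) {u : B}
    (hu : u ∈ unitary B) : funOf (toComplex f) u ∈ unitary B := by
  refine (cfc_unitary_iff _ u (isStarNormal_of_unitary hu)
    (continuousOn_spectrum _ hu)).2 fun z hz => ?_
  obtain ⟨w, rfl⟩ := mem_circle_of_spectrum hu hz
  rw [extend_coe]
  simp [toComplex, ← Complex.normSq_eq_conj_mul_self]

theorem funOf_commute {B : Type*} [CStarAlgebra B] (h : C(Circle, ℂ)) {u : B}
    (hu : u ∈ unitary B) : funOf h u * u = u * funOf h u := by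
  have := isStarNormal_of_unitary hu
  have h2 := cfc_commute_cfc (Function.extend (fun z : Circle => (z : ℂ)) h 0) (id : ℂ → ℂ) u
  rw [cfc_id ℂ u] at h2
  exact h2

/-! ### The noncommutative 2-torus -/

/-- A pair of unitaries `u, v` with `u v = e^{2πiα} v u` in a nonzero unital C⋆-algebra. -/
structure Rep.{w} (α : ℝ) : Type (w + 1) where
  carrier : Type w
  [cstar : CStarAlgebra carrier]
  [nontriv : Nontrivial carrier]
  u : carrier
  v : carrier
  u_mem : u ∈ unitary carrier
  v_mem : v ∈ unitary carrier
  comm : u * v = Complex.exp (2 * Real.pi * Complex.I * α) • (v * u)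

attribute [instance] Rep.cstar Rep.nontriv

/-- The C⋆-algebra of bounded families indexed by all such pairs, with the supremum norm. -/
abbrev Ambient.{w} (α : ℝ) : Type (w + 1) := lp (fun i : Rep.{w} α => i.carrier) ∞

instance ambientCStarAlgebra.{w} (α : ℝ) : CStarAlgebra (Ambient.{w} α) where
  norm_mul_self_le x := CStarRing.norm_star_mul_self (x := x) |>.symm.le

theorem memℓp_of_unitary.{w} {α : ℝ} (x : ∀ i : Rep.{w} α, i.carrier)
    (hx : ∀ i, x i ∈ unitary i.carrier) : Memℓp x ∞ :=
  memℓp_infty ⟨1, by rintro _ ⟨i, rfl⟩; exact (CStarRing.norm_of_mem_unitary (hx i)).le⟩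

/-- The universal pair of unitaries, inside the algebra of bounded families. -/
def ambientU.{w} (α : ℝ) : Ambient.{w} α :=
  ⟨fun i => i.u, memℓp_of_unitary _ fun i => i.u_mem⟩

def ambientV.{w} (α : ℝ) : Ambient.{w} α :=
  ⟨fun i => i.v, memℓp_of_unitary _ fun i => i.v_mem⟩

/-- The noncommutative torus as a C⋆-subalgebra of `Ambient α`. -/
def torusSubalgebra.{w} (α : ℝ) : StarSubalgebra ℂ (Ambient.{w} α) :=
  (StarAlgebra.adjoin ℂ {ambientU.{w} α, ambientV.{w} α}).topologicalClosure

instance isClosed_torusSubalgebra.{w} (α : ℝ) :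
    IsClosed (torusSubalgebra.{w} α : Set (Ambient.{w} α)) :=
  StarSubalgebra.isClosed_topologicalClosure _

/-- The noncommutative torus `𝔸_α`: the universal unital C⋆-algebra generated by two unitaries
`U, V` with `U V = e^{2πiα} V U`. Its norm on the polynomials in `U, V, U⋆, V⋆` is the supremum of
the norms in all pairs of unitaries satisfying this relation. -/
abbrev Torus.{w} (α : ℝ) : Type (w + 1) := torusSubalgebra.{w} α

theorem ambientU_mem.{w} (α : ℝ) : ambientU.{w} α ∈ torusSubalgebra.{w} α :=
  StarSubalgebra.le_topologicalClosure _ (StarAlgebra.subset_adjoin ℂ _ (by simp))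

theorem ambientV_mem.{w} (α : ℝ) : ambientV.{w} α ∈ torusSubalgebra.{w} α :=
  StarSubalgebra.le_topologicalClosure _ (StarAlgebra.subset_adjoin ℂ _ (by simp))

/-- The generators `U` and `V` of `𝔸_α`. -/
def U.{w} (α : ℝ) : Torus.{w} α := ⟨ambientU α, ambientU_mem α⟩

def V.{w} (α : ℝ) : Torus.{w} α := ⟨ambientV α, ambientV_mem α⟩

/-- The coordinate homomorphism at a pair `(u, v)`, which maps `U` to `u` and `V` to `v`. -/
def evalAmbient.{w} {α : ℝ} (i : Rep.{w} α) : Ambient.{w} α →⋆ₐ[ℂ] i.carrier where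
  toFun x := x i
  map_one' := rfl
  map_mul' _ _ := rfl
  map_zero' := rfl
  map_add' _ _ := rfl
  commutes' _ := rfl
  map_star' _ := rfl

theorem ambientU_unitary.{w} (α : ℝ) : ambientU.{w} α ∈ unitary (Ambient.{w} α) := by
  rw [Unitary.mem_iff]
  exact ⟨lp.ext (funext fun i => Unitary.star_mul_self_of_mem i.u_mem),
    lp.ext (funext fun i => Unitary.mul_star_self_of_mem i.u_mem)⟩

theorem U_unitary.{w} (α : ℝ) : U.{w} α ∈ unitary (Torus.{w} α) := by
  have h := Unitary.mem_iff.1 (ambientU_unitary.{w} α)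
  exact Unitary.mem_iff.2 ⟨Subtype.ext h.1, Subtype.ext h.2⟩

theorem V_unitary.{w} (α : ℝ) : V.{w} α ∈ unitary (Torus.{w} α) := by
  rw [Unitary.mem_iff]
  exact ⟨Subtype.ext (lp.ext (funext fun i => Unitary.star_mul_self_of_mem i.v_mem)),
    Subtype.ext (lp.ext (funext fun i => Unitary.mul_star_self_of_mem i.v_mem))⟩

theorem U_mul_V.{w} (α : ℝ) :
    U.{w} α * V α = Complex.exp (2 * Real.pi * Complex.I * α) • (V α * U α) :=
  Subtype.ext (lp.ext (funext fun i => i.comm))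

/-- Two `⋆`-homomorphisms out of `𝔸_α` that agree on `U` and `V` are equal. -/
theorem hom_ext.{w, w'} {α : ℝ} {B : Type w'} [CStarAlgebra B] {φ ψ : Torus.{w} α →⋆ₐ[ℂ] B}
    (hU : φ (U α) = ψ (U α)) (hV : φ (V α) = ψ (V α)) : φ = ψ := by
  refine StarAlgHom.ext_topologicalClosure (continuous_hom φ) (continuous_hom ψ) ?_
  refine StarAlgHom.ext_adjoin fun x hx => ?_
  rcases x with ⟨x, hx'⟩
  simp only [Set.mem_insert_iff, Set.mem_singleton_iff] at hx
  rcases hx with rfl | rfl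
  · exact hU
  · exact hV

/-- The universal property of `𝔸_α`. -/
theorem existsUnique_lift.{w} {α : ℝ} {B : Type w} [CStarAlgebra B] {u v : B}
    (hu : u ∈ unitary B) (hv : v ∈ unitary B)
    (huv : u * v = Complex.exp (2 * Real.pi * Complex.I * α) • (v * u)) :
    ∃! φ : Torus.{w} α →⋆ₐ[ℂ] B, φ (U α) = u ∧ φ (V α) = v := by
  have key : ∃ φ : Torus.{w} α →⋆ₐ[ℂ] B, φ (U α) = u ∧ φ (V α) = v := by
    rcases subsingleton_or_nontrivial B with h | h
    · exact ⟨{ toFun := fun _ => 0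
               map_one' := Subsingleton.elim _ _
               map_mul' := fun _ _ => Subsingleton.elim _ _
               map_zero' := rfl
               map_add' := fun _ _ => Subsingleton.elim _ _
               commutes' := fun _ => Subsingleton.elim _ _
               map_star' := fun _ => Subsingleton.elim _ _ },
        Subsingleton.elim _ _, Subsingleton.elim _ _⟩
    · exact ⟨(evalAmbient ⟨B, u, v, hu, hv, huv⟩).comp (torusSubalgebra α).subtype, rfl, rfl⟩
  obtain ⟨φ, h⟩ := key
  exact ⟨φ, h, fun ψ hψ => hom_ext (hψ.1.trans h.1.symm) (hψ.2.trans h.2.symm)⟩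

/-! ### The Anzai skew-product -/

/-- The pair `(e^{iθ} u, f(u) v)`, which satisfies the same relations as `(u, v)`. -/
def Rep.skew.{w} {α : ℝ} (θ : ℝ) (f : C(Circle, Circle)) (i : Rep.{w} α) : Rep.{w} α where
  carrier := i.carrier
  u := (Circle.exp θ : ℂ) • i.u
  v := funOf (toComplex f) i.u * i.v
  u_mem := by
    have h := Unitary.mem_iff.1 i.u_mem
    have e : (starRingEnd ℂ) (Circle.exp θ : ℂ) * (Circle.exp θ : ℂ) = 1 := by
      rw [← Complex.normSq_eq_conj_mul_self, Circle.normSq_coe, Complex.ofReal_one]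
    rw [Unitary.mem_iff]
    constructor
    · rw [star_smul, smul_mul_smul_comm, h.1, Complex.star_def, e, one_smul]
    · rw [star_smul, smul_mul_smul_comm, h.2, Complex.star_def, mul_comm, e, one_smul]
  v_mem := mul_mem (funOf_mem_unitary f i.u_mem) i.v_mem
  comm := by
    rw [smul_mul_assoc, ← mul_assoc, ← funOf_commute _ i.u_mem, mul_assoc, i.comm,
      mul_smul_comm, mul_smul_comm, smul_comm, ← mul_assoc]

/-- The map `x ↦ (x_{(e^{iθ}u, f(u)v)})_{(u,v)}` on bounded families. -/
def ambientSkew.{w} (α θ : ℝ) (f : C(Circle, Circle)) :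
    Ambient.{w} α →⋆ₐ[ℂ] Ambient.{w} α where
  toFun x := ⟨fun i => (x (i.skew θ f) : (i.skew θ f).carrier),
    memℓp_infty ⟨‖x‖, by
      rintro _ ⟨i, rfl⟩
      exact lp.norm_apply_le_norm ENNReal.top_ne_zero x (i.skew θ f)⟩⟩
  map_one' := rfl
  map_mul' _ _ := rfl
  map_zero' := rfl
  map_add' _ _ := rfl
  commutes' _ := rfl
  map_star' _ := rfl

theorem coe_funOf_U.{w} (α : ℝ) (h : C(Circle, ℂ)) :
    ((funOf h (U.{w} α) : Torus.{w} α) : Ambient.{w} α) = funOf h (ambientU.{w} α) :=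
  map_funOf (torusSubalgebra.{w} α).subtype h (U_unitary α)

theorem funOf_ambientU_apply.{w} {α : ℝ} (h : C(Circle, ℂ)) (i : Rep.{w} α) :
    (funOf h (ambientU.{w} α) : Ambient.{w} α) i = funOf h i.u :=
  map_funOf (evalAmbient i) h (ambientU_unitary α)

theorem ambientSkew_U.{w} (α θ : ℝ) (f : C(Circle, Circle)) :
    ambientSkew.{w} α θ f (ambientU α) = ((Circle.exp θ : ℂ) • U.{w} α : Torus.{w} α) := rfl

theorem ambientSkew_V.{w} (α θ : ℝ) (f : C(Circle, Circle)) :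
    ambientSkew.{w} α θ f (ambientV α) = (funOf (toComplex f) (U.{w} α) * V α : Torus.{w} α) := by
  change _ = (funOf (toComplex f) (U.{w} α) : Torus.{w} α).1 * ambientV α
  rw [coe_funOf_U]
  refine lp.ext (funext fun i => ?_)
  change funOf (toComplex f) i.u * i.v = (funOf (toComplex f) (ambientU.{w} α) : Ambient.{w} α) i * i.v
  rw [funOf_ambientU_apply]

theorem ambientSkew_mem.{w} (α θ : ℝ) (f : C(Circle, Circle)) (x : Torus.{w} α) :
    ambientSkew.{w} α θ f x ∈ torusSubalgebra.{w} α := by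
  have h : torusSubalgebra.{w} α ≤ (torusSubalgebra.{w} α).comap (ambientSkew.{w} α θ f) := by
    refine StarSubalgebra.topologicalClosure_minimal ?_
      ((isClosed_torusSubalgebra α).preimage (continuous_hom (ambientSkew.{w} α θ f)))
    refine StarAlgebra.adjoin_le ?_
    rintro y (rfl | rfl)
    · change ambientSkew.{w} α θ f (ambientU α) ∈ torusSubalgebra.{w} α
      rw [ambientSkew_U]; exact Subtype.property _
    · change ambientSkew.{w} α θ f (ambientV α) ∈ torusSubalgebra.{w} α
      rw [ambientSkew_V]; exact Subtype.property _
  exact h x.2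

/-- The unital `⋆`-homomorphism of `𝔸_α` with `U ↦ e^{iθ} U` and `V ↦ f(U) V`. -/
def skewHom.{w} (α θ : ℝ) (f : C(Circle, Circle)) : Torus.{w} α →⋆ₐ[ℂ] Torus.{w} α :=
  StarAlgHom.codRestrict ((ambientSkew.{w} α θ f).comp (torusSubalgebra.{w} α).subtype)
    (torusSubalgebra.{w} α) (ambientSkew_mem α θ f)

theorem skewHom_U.{w} (α θ : ℝ) (f : C(Circle, Circle)) :
    skewHom.{w} α θ f (U α) = (Circle.exp θ : ℂ) • U α := rfl

theorem skewHom_V.{w} (α θ : ℝ) (f : C(Circle, Circle)) :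
    skewHom.{w} α θ f (V α) = funOf (toComplex f) (U α) * V α :=
  Subtype.ext (ambientSkew_V α θ f)

/-- The function `z ↦ conj (f (e^{-iθ} z))`, which gives the inverse skew-product. -/
def skewInv (θ : ℝ) (f : C(Circle, Circle)) : C(Circle, Circle) :=
  ⟨fun z => (f (Circle.exp (-θ) * z))⁻¹, by fun_prop⟩

theorem funOf_smul_mul {B : Type*} [CStarAlgebra B] (θ : ℝ) (f g : C(Circle, Circle)) {u : B}
    (hu : u ∈ unitary B) (h : ∀ z, g (Circle.exp θ * z) * f z = 1) :
    funOf (toComplex g) ((Circle.exp θ : ℂ) • u) * funOf (toComplex f) u = 1 := by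
  have hn := isStarNormal_of_unitary hu
  have hs : Set.MapsTo (fun z => (Circle.exp θ : ℂ) * z) (spectrum ℂ u)
      (Metric.sphere (0 : ℂ) 1) := by
    intro z hz
    have := spectrum.subset_circle_of_unitary hu hz
    rw [mem_sphere_zero_iff_norm] at this ⊢
    rw [norm_mul, Circle.norm_coe, this, one_mul]
  have hc : ContinuousOn (fun z => Function.extend (fun z : Circle => (z : ℂ)) (toComplex g) 0
      ((Circle.exp θ : ℂ) * z)) (spectrum ℂ u) :=
    (continuousOn_extend _).comp (by fun_prop) hs
  have h1 : funOf (toComplex g) ((Circle.exp θ : ℂ) • u) =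
      cfc (fun z => Function.extend (fun z : Circle => (z : ℂ)) (toComplex g) 0
        ((Circle.exp θ : ℂ) * z)) u :=
    (cfc_comp_const_mul _ _ u ((continuousOn_extend _).mono hs.image_subset) hn).symm
  rw [h1, funOf, ← cfc_mul _ _ u hc (continuousOn_spectrum _ hu), ← cfc_one ℂ u]
  refine cfc_congr fun z hz => ?_
  obtain ⟨w, rfl⟩ := mem_circle_of_spectrum hu hz
  have := congrArg (fun c : Circle => (c : ℂ)) (h w)
  change Function.extend (fun z : Circle => (z : ℂ)) (toComplex g) 0
    ((Circle.exp θ * w : Circle) : ℂ) *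
    Function.extend (fun z : Circle => (z : ℂ)) (toComplex f) 0 (w : ℂ) = 1
  rw [extend_coe, extend_coe]
  exact this

theorem skewHom_skewHom.{w} (α θ θ' : ℝ) (f g : C(Circle, Circle)) (hθ : θ + θ' = 0)
    (h : ∀ z, g (Circle.exp θ * z) * f z = 1) (x : Torus.{w} α) :
    skewHom.{w} α θ f (skewHom.{w} α θ' g x) = x := by
  have key : (skewHom.{w} α θ f).comp (skewHom.{w} α θ' g) = StarAlgHom.id ℂ (Torus.{w} α) := by
    refine hom_ext ?_ ?_
    · rw [StarAlgHom.comp_apply, skewHom_U, map_smul, skewHom_U, smul_smul, ← Circle.coe_mul,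
        ← Circle.exp_add, add_comm, hθ, Circle.exp_zero, Circle.coe_one, one_smul]
      rfl
    · rw [StarAlgHom.comp_apply, skewHom_V, map_mul, map_funOf _ _ (U_unitary α), skewHom_U,
        skewHom_V, ← mul_assoc, funOf_smul_mul θ f g (U_unitary α) h, one_mul]
      rfl
  exact DFunLike.congr_fun key x

/-- The Anzai skew-product `Φ_{θ,f}`: the `⋆`-automorphism of `𝔸_α` with `U ↦ e^{iθ} U` and
`V ↦ f(U) V`. -/
def anzai.{w} (α θ : ℝ) (f : C(Circle, Circle)) : Torus.{w} α ≃⋆ₐ[ℂ] Torus.{w} α :=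
  StarAlgEquiv.ofStarAlgHom (skewHom α θ f) (skewHom α (-θ) (skewInv θ f))
    (StarAlgHom.ext fun x => skewHom_skewHom α (-θ) θ (skewInv θ f) f (neg_add_cancel θ)
      (fun z => mul_inv_cancel (f (Circle.exp (-θ) * z))) x)
    (StarAlgHom.ext fun x => skewHom_skewHom α θ (-θ) f (skewInv θ f) (add_neg_cancel θ)
      (fun z => by
        change (f (Circle.exp (-θ) * (Circle.exp θ * z)))⁻¹ * f z = 1
        rw [← mul_assoc, ← Circle.exp_add, neg_add_cancel, Circle.exp_zero, one_mul,
          inv_mul_cancel]) x)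

theorem anzai_U.{w} (α θ : ℝ) (f : C(Circle, Circle)) :
    anzai.{w} α θ f (U α) = Complex.exp (θ * Complex.I) • U α := by
  rw [← Circle.coe_exp]
  exact skewHom_U α θ f

theorem anzai_V.{w} (α θ : ℝ) (f : C(Circle, Circle)) :
    anzai.{w} α θ f (V α) = funOf (toComplex f) (U α) * V α :=
  skewHom_V α θ f

/-! ### Topological ergodicity and the cohomological equation -/

/-- The fixed-point subalgebra of a `⋆`-automorphism. -/
def fixedPoints {A : Type*} [CStarAlgebra A] (Φ : A ≃⋆ₐ[ℂ] A) : StarSubalgebra ℂ A where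
  carrier := {a | Φ a = a}
  mul_mem' ha hb := by rw [Set.mem_ofPred_eq, map_mul, ha, hb]
  add_mem' ha hb := by rw [Set.mem_ofPred_eq, map_add, ha, hb]
  algebraMap_mem' c := by
    rw [Set.mem_ofPred_eq, Algebra.algebraMap_eq_smul_one, map_smul, map_one]
  star_mem' ha := by rw [Set.mem_ofPred_eq, map_star, ha]

/-- Topological ergodicity: the fixed-point subalgebra consists of the scalar multiples of `1`. -/
def TopologicallyErgodic {A : Type*} [CStarAlgebra A] (Φ : A ≃⋆ₐ[ℂ] A) : Prop :=
  (fixedPoints Φ : Set A) = {a | ∃ c : ℂ, a = c • (1 : A)}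

/-- The functions `f_n`: `∏_{l=0}^{n-1} f ∘ R_{-lα}` for `n ≥ 0` (the empty product `1` for `n = 0`)
and `∏_{l=1}^{|n|} conj (f ∘ R_{lα})` for `n < 0`. -/
def cocycle (α : ℝ) (f : C(Circle, Circle)) : ℤ → Circle → ℂ
  | Int.ofNat n, z => ∏ l ∈ Finset.range n, (f (rot (-(l * α)) z) : ℂ)
  | Int.negSucc m, z => ∏ l ∈ Finset.Icc 1 (m + 1), conj (f (rot (l * α) z) : ℂ)

/-- The cohomological equation `(g ∘ R_{θ/2π}) f_n = g` for `g ∈ C(𝕋)`. -/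
def SolvesCohomological (α θ : ℝ) (f : C(Circle, Circle)) (n : ℤ) (g : C(Circle, ℂ)) : Prop :=
  ∀ z : Circle, g (rot (θ / (2 * Real.pi)) z) * cocycle α f n z = g z

end NCTorus

end

universe w

noncomputable section

namespace NCTorus

/-! ### A concrete pair of unitaries -/

/-! The circle acts on the torus by gauge automorphisms, which fix `U` and send `V` to `t V`. An
element is determined by its Fourier components for this action (`eq_zero_of_component_eq_zero`),
and the component of degree `n` has the form `g(U) Vⁿ` with `g ∈ C(𝕋)` (`exists_component_eq`). The
skew-product commutes with the gauge action, hence with taking components (`anzai_component`), so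
all components of a fixed element are fixed. Since `Φ(g(U) Vⁿ) = ((g ∘ R) f_n)(U) Vⁿ`, fixing `g(U)
Vⁿ` is exactly the cohomological equation for `g` (`anzai_funOf_mul_vPow_eq_iff`).

A non-zero solution in degree `n ≠ 0` thus gives a fixed element that is not scalar, because scalars
live in degree `0`. Conversely, if there are no such solutions, a fixed element has only its degree
`0` component `g(U)`; there `f_0 = 1`, and density of the orbits of an irrational rotation makes `g`
constant.

Passing back from `g(U)` to `g` needs the spectrum of `U` to be the whole circle (`mem_spectrum_U`).
This follows from the symmetry `U ↦ c U` once the algebra is known to be non-zero, which the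
representation on `ℓ²(ℤ)` provides. -/

/-- The operator `x ↦ (i ↦ c i * x (σ i))` on `ℓ²(ι)`. -/
def weightedShift {ι : Type*} (σ : ι ≃ ι) (c : ι → Circle) :
    lp (fun _ : ι => ℂ) 2 ≃ₗᵢ[ℂ] lp (fun _ : ι => ℂ) 2 where
  toFun x := ⟨fun i => c i * x (σ i), by
    refine memℓp_gen ?_
    simp only [norm_mul, Circle.norm_coe, one_mul]
    exact ((memℓp_gen_iff (by norm_num)).1 (lp.memℓp x)).comp_injective σ.injective⟩
  invFun x := ⟨fun i => (c (σ.symm i))⁻¹ * x (σ.symm i), by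
    refine memℓp_gen ?_
    simp only [norm_mul, Circle.norm_coe, one_mul]
    exact ((memℓp_gen_iff (by norm_num)).1 (lp.memℓp x)).comp_injective σ.symm.injective⟩
  map_add' x y := lp.ext (funext fun i => mul_add (c i : ℂ) (x (σ i)) (y (σ i)))
  map_smul' r x := lp.ext (funext fun i => mul_left_comm (c i : ℂ) r (x (σ i)))
  left_inv x := lp.ext (funext fun i => by simp)
  right_inv x := lp.ext (funext fun i => by simp)
  norm_map' x := by
    rw [lp.norm_eq_tsum_rpow (by norm_num), lp.norm_eq_tsum_rpow (by norm_num)]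
    congr 1
    refine Eq.trans (tsum_congr fun i => ?_) (σ.tsum_eq fun i => ‖x i‖ ^ (2 : ℝ≥0∞).toReal)
    change ‖(c i : ℂ) * x (σ i)‖ ^ _ = _
    rw [norm_mul, Circle.norm_coe, one_mul]

/-- The pair of a diagonal operator and the bilateral shift on `ℓ²(ℤ)`. -/
def shiftRep (α : ℝ) : Rep.{w} α where
  -- `ULift` puts the Hilbert space in the universe `w` over which the representations range.
  carrier := lp (fun _ : ULift.{w} ℤ => ℂ) 2 →L[ℂ] lp (fun _ : ULift.{w} ℤ => ℂ) 2
  nontriv := by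
    have : Nontrivial (lp (fun _ : ULift.{w} ℤ => ℂ) 2) :=
      ⟨lp.single 2 ⟨0⟩ 1, 0, fun h => by
        have := congrArg (fun x : lp (fun _ : ULift.{w} ℤ => ℂ) 2 => x ⟨0⟩) h
        simp at this⟩
    infer_instance
  u := Unitary.linearIsometryEquiv.symm
    (weightedShift (Equiv.refl _) fun n : ULift.{w} ℤ => Circle.exp (2 * Real.pi * α * n.down))
  v := Unitary.linearIsometryEquiv.symm
    (weightedShift (Equiv.ulift.trans ((Equiv.subRight (1 : ℤ)).trans Equiv.ulift.symm)) fun _ : ULift.{w} ℤ => 1)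
  u_mem := Subtype.property _
  v_mem := Subtype.property _
  comm := by
    ext x n
    change (Circle.exp (2 * Real.pi * α * n.down) : ℂ) *
      (((1 : Circle) : ℂ) * x ⟨n.down - 1⟩) = Complex.exp (2 * Real.pi * Complex.I * α) *
      (((1 : Circle) : ℂ) * (Circle.exp (2 * Real.pi * α * (n.down - 1 : ℤ)) * x ⟨n.down - 1⟩))
    simp only [Circle.coe_one, one_mul, ← mul_assoc, Circle.coe_exp, ← Complex.exp_add]
    congr 2
    push_cast
    ring

/-- A single representation on a non-zero space suffices: its coordinate separates `1` from `0`.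
This is what makes the spectrum of `U` non-empty. -/
instance nontrivial_torus (α : ℝ) : Nontrivial (Torus.{w} α) :=
  ⟨1, 0, fun h => one_ne_zero (α := (shiftRep.{w} α).carrier)
    (congrArg (fun x : Torus.{w} α => x.1 (shiftRep α)) h)⟩

/-! ### The functional calculus of a unitary -/

section FunctionalCalculus

variable {B : Type*} [CStarAlgebra B] {u : B}

theorem funOf_mul (h k : C(Circle, ℂ)) (hu : u ∈ unitary B) :
    funOf (h * k) u = funOf h u * funOf k u := by
  rw [funOf, funOf, funOf, ← cfc_mul _ _ u (continuousOn_spectrum h hu) (continuousOn_spectrum k hu)]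
  refine cfc_congr fun z hz => ?_
  obtain ⟨w, rfl⟩ := mem_circle_of_spectrum hu hz
  simp only [extend_coe, ContinuousMap.mul_apply]

theorem funOf_const (c : ℂ) (hu : u ∈ unitary B) :
    funOf (ContinuousMap.const Circle c) u = c • (1 : B) := by
  rw [← Algebra.algebraMap_eq_smul_one, ← cfc_const c u (isStarNormal_of_unitary hu)]
  refine cfc_congr fun z hz => ?_
  obtain ⟨w, rfl⟩ := mem_circle_of_spectrum hu hz
  rw [extend_coe, ContinuousMap.const_apply]

theorem funOf_one (hu : u ∈ unitary B) : funOf 1 u = 1 := by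
  rw [show (1 : C(Circle, ℂ)) = ContinuousMap.const Circle 1 from rfl, funOf_const 1 hu, one_smul]

theorem funOf_smul (h : C(Circle, ℂ)) (c : Circle) (hu : u ∈ unitary B) :
    funOf h ((c : ℂ) • u) = funOf (h.comp (ContinuousMap.mulLeft c)) u := by
  have hs : Set.MapsTo (fun z => (c : ℂ) * z) (spectrum ℂ u) (Metric.sphere (0 : ℂ) 1) := by
    intro z hz
    obtain ⟨w, rfl⟩ := mem_circle_of_spectrum hu hz
    rw [mem_sphere_zero_iff_norm, norm_mul, Circle.norm_coe, Circle.norm_coe, one_mul]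
  rw [funOf, ← cfc_comp_const_mul _ _ u ((continuousOn_extend _).mono hs.image_subset)
    (isStarNormal_of_unitary hu)]
  refine cfc_congr fun z hz => ?_
  obtain ⟨w, rfl⟩ := mem_circle_of_spectrum hu hz
  change Function.extend (fun z : Circle => (z : ℂ)) h 0 ((c * w : Circle) : ℂ) = _
  rw [extend_coe, extend_coe, ContinuousMap.comp_apply, ContinuousMap.coe_mulLeft]

/-- The functions of `u`, as a C⋆-subalgebra. -/
def functionsOf (hu : u ∈ unitary B) : StarSubalgebra ℂ B :=
  (cfcHom (isStarNormal_of_unitary hu) : C(spectrum ℂ u, ℂ) →⋆ₐ[ℂ] B).range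

/-- The continuous functional calculus is a closed embedding of `C(spectrum ℂ u, ℂ)`. -/
theorem isClosed_functionsOf (hu : u ∈ unitary B) : IsClosed (functionsOf hu : Set B) :=
  (cfcHom_isClosedEmbedding (isStarNormal_of_unitary hu)).isClosed_range

theorem funOf_mem_functionsOf (h : C(Circle, ℂ)) (hu : u ∈ unitary B) :
    funOf h u ∈ functionsOf hu :=
  ⟨⟨_, (continuousOn_spectrum h hu).domRestrict⟩,
    (cfc_apply _ u (isStarNormal_of_unitary hu) (continuousOn_spectrum h hu)).symm⟩

theorem self_mem_functionsOf (hu : u ∈ unitary B) : u ∈ functionsOf hu :=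
  ⟨_, cfcHom_id (isStarNormal_of_unitary hu)⟩

theorem exists_eq_funOf (hu : u ∈ unitary B) (hs : ∀ z : Circle, (z : ℂ) ∈ spectrum ℂ u) {x : B}
    (hx : x ∈ functionsOf hu) : ∃ h : C(Circle, ℂ), x = funOf h u := by
  obtain ⟨k, rfl⟩ := hx
  refine ⟨k.comp ⟨fun z => ⟨z, hs z⟩, by fun_prop⟩, ?_⟩
  change cfcHom (isStarNormal_of_unitary hu) k = _
  rw [cfcHom_eq_cfc_extend 0]
  refine cfc_congr fun z hz => ?_
  obtain ⟨w, rfl⟩ := mem_circle_of_spectrum hu hz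
  rw [extend_coe]
  exact Subtype.val_injective.extend_apply k 0 ⟨w, hz⟩

theorem funOf_injective (hu : u ∈ unitary B) (hs : ∀ z : Circle, (z : ℂ) ∈ spectrum ℂ u) :
    Function.Injective fun h : C(Circle, ℂ) => funOf h u := by
  intro h k hhk
  ext z
  have := (cfc_eq_cfc_iff_eqOn (ha := isStarNormal_of_unitary hu) (hf := continuousOn_spectrum h hu)
    (hg := continuousOn_spectrum k hu)).1 hhk (hs z)
  simpa only [extend_coe] using this

end FunctionalCalculus

/-! ### Induction on the noncommutative torus -/

/-- The torus is closed in the ambient algebra, so `K` is closed there too and contains the closure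
of the polynomials in the generators. -/
theorem eq_top_of_isClosed {α : ℝ} {K : StarSubalgebra ℂ (Torus.{w} α)}
    (hK : IsClosed (K : Set (Torus.{w} α))) (hU : U α ∈ K) (hV : V α ∈ K) : K = ⊤ := by
  have h : torusSubalgebra.{w} α ≤ K.map (torusSubalgebra.{w} α).subtype := by
    refine StarSubalgebra.topologicalClosure_minimal (StarAlgebra.adjoin_le ?_)
      ((isClosed_torusSubalgebra α).isClosedEmbedding_subtypeVal.isClosedMap _ hK)
    rintro x (rfl | rfl)
    · exact ⟨U α, hU, rfl⟩
    · exact ⟨V α, hV, rfl⟩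
  refine eq_top_iff.2 fun x _ => ?_
  obtain ⟨y, hy, hyx⟩ := h x.2
  rwa [← Subtype.ext (a1 := y) (a2 := x) hyx]

/-- A closed subspace containing `1` that is stable under left multiplication by `U`, `V` and their
adjoints is everything. -/
theorem mem_of_mul_left_stable {α : ℝ} {M : Submodule ℂ (Torus.{w} α)}
    (hM : IsClosed (M : Set (Torus.{w} α))) (h1 : 1 ∈ M)
    (hU : ∀ b ∈ M, U α * b ∈ M) (hU' : ∀ b ∈ M, star (U α) * b ∈ M)
    (hV : ∀ b ∈ M, V α * b ∈ M) (hV' : ∀ b ∈ M, star (V α) * b ∈ M) (x : Torus.{w} α) :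
    x ∈ M := by
  -- The left multipliers of `M`, required together with their adjoints, form a closed ⋆-subalgebra
  -- containing the generators; applying a multiplier to `1 ∈ M` finishes.
  let K : StarSubalgebra ℂ (Torus.{w} α) :=
    { carrier := {x | ∀ b ∈ M, x * b ∈ M ∧ star x * b ∈ M}
      mul_mem' := fun {x y} hx hy b hb => by
        rw [star_mul, mul_assoc, mul_assoc]
        exact ⟨(hx _ (hy _ hb).1).1, (hy _ (hx _ hb).2).2⟩
      add_mem' := fun {x y} hx hy b hb => by
        rw [star_add, add_mul, add_mul]
        exact ⟨M.add_mem (hx _ hb).1 (hy _ hb).1, M.add_mem (hx _ hb).2 (hy _ hb).2⟩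
      algebraMap_mem' := fun c b hb => by
        rw [← algebraMap_star_comm, ← Algebra.smul_def, ← Algebra.smul_def]
        exact ⟨M.smul_mem _ hb, M.smul_mem _ hb⟩
      star_mem' := fun {x} hx b hb => by
        rw [star_star]
        exact (hx b hb).symm }
  have hK : IsClosed (K : Set (Torus.{w} α)) := by
    have : (K : Set (Torus.{w} α)) =
        ⋂ b ∈ M, ((· * b) ⁻¹' (M : Set (Torus.{w} α)) ∩
          (fun x => star x * b) ⁻¹' (M : Set (Torus.{w} α))) := by
      ext x
      simp only [Set.mem_iInter]
      rfl
    rw [this]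
    exact isClosed_biInter fun b _ =>
      (hM.preimage (by fun_prop)).inter (hM.preimage (by fun_prop))
  have hx : x ∈ K := by
    rw [eq_top_of_isClosed hK (fun b hb => ⟨hU b hb, hU' b hb⟩) fun b hb => ⟨hV b hb, hV' b hb⟩]
    trivial
  simpa using (hx 1 h1).1

/-! ### The generators -/

/-- With `f = 1` the skew-product is an automorphism `U ↦ c U`, so the spectrum is invariant under
every rotation. Being a non-empty subset of the circle, it is all of it. -/
theorem mem_spectrum_U (α : ℝ) (z : Circle) : (z : ℂ) ∈ spectrum ℂ (U.{w} α) := by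
  obtain ⟨x, hx⟩ := spectrum.nonempty (U.{w} α)
  obtain ⟨y, rfl⟩ := mem_circle_of_spectrum (U_unitary α) hx
  have h := AlgEquiv.spectrum_eq (anzai.{w} α (Complex.arg (z / y : Circle)) 1) (U α)
  rw [show anzai.{w} α (Complex.arg (z / y : Circle)) 1 (U α) = _ from skewHom_U α _ _,
    Circle.exp_arg, spectrum.smul_eq_smul _ _ ⟨_, hx⟩] at h
  rw [← h]
  refine ⟨y, hx, ?_⟩
  change ((z / y : Circle) : ℂ) * (y : ℂ) = z
  rw [← Circle.coe_mul, div_mul_cancel]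

theorem funOf_U_injective (α : ℝ) :
    Function.Injective fun h : C(Circle, ℂ) => funOf h (U.{w} α) :=
  funOf_injective (U_unitary α) (mem_spectrum_U α)

/-- The integral powers of `V`. -/
def vPow (α : ℝ) (n : ℤ) : Torus.{w} α :=
  ((⟨V α, V_unitary α⟩ : unitary (Torus.{w} α)) ^ n : unitary (Torus.{w} α))

theorem vPow_zero (α : ℝ) : vPow.{w} α 0 = 1 := rfl

theorem vPow_add_one (α : ℝ) (n : ℤ) : vPow.{w} α (n + 1) = V α * vPow α n := by
  rw [vPow, zpow_add, zpow_one, (Commute.self_zpow _ n).eq.symm]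
  rfl

theorem vPow_add_one' (α : ℝ) (n : ℤ) : vPow.{w} α (n + 1) = vPow α n * V α := by
  rw [vPow, zpow_add, zpow_one]
  rfl

theorem vPow_sub_one (α : ℝ) (n : ℤ) : vPow.{w} α (n - 1) = vPow α n * star (V α) := by
  rw [vPow, zpow_sub, zpow_one]
  rfl

theorem vPow_mul_vPow_neg (α : ℝ) (n : ℤ) : vPow.{w} α n * vPow α (-n) = 1 := by
  rw [vPow, vPow, zpow_neg]
  exact Unitary.mul_star_self_of_mem (Subtype.property _)

theorem mul_vPow_cancel {α : ℝ} {n : ℤ} {x y : Torus.{w} α}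
    (h : x * vPow α n = y * vPow α n) : x = y := by
  have := congrArg (· * vPow α (-n)) h
  simpa only [mul_assoc, vPow_mul_vPow_neg, mul_one] using this

/-! ### Rotations and the covariance relation between `U` and `V` -/

/-- The rotation by `e^{2πia}` as a continuous map. -/
def rotMap (a : ℝ) : C(Circle, Circle) := ContinuousMap.mulLeft (Circle.exp (2 * Real.pi * a))

theorem rotMap_apply (a : ℝ) (z : Circle) : rotMap a z = rot a z := rfl

theorem rot_rot (a b : ℝ) (z : Circle) : rot a (rot b z) = rot (a + b) z := by
  rw [rot, rot, rot, ← mul_assoc, ← Circle.exp_add, mul_add]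

theorem rot_zero (z : Circle) : rot 0 z = z := by
  rw [rot, mul_zero, Circle.exp_zero, one_mul]

theorem mul_mul_star_eq_smul {B : Type*} [CStarAlgebra B] {α : ℝ} {u v : B} (hv : v ∈ unitary B)
    (huv : u * v = Complex.exp (2 * Real.pi * Complex.I * α) • (v * u)) :
    v * u * star v = (Circle.exp (2 * Real.pi * -α) : ℂ) • u := by
  have e : (Circle.exp (2 * Real.pi * -α) : ℂ) * Complex.exp (2 * Real.pi * Complex.I * α) = 1 := by
    rw [Circle.coe_exp, ← Complex.exp_add, Complex.exp_eq_one_iff]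
    exact ⟨0, by push_cast; ring⟩
  have h : v * u = (Circle.exp (2 * Real.pi * -α) : ℂ) • (u * v) := by
    rw [huv, smul_smul, e, one_smul]
  rw [h, smul_mul_assoc, mul_assoc u, Unitary.mul_star_self_of_mem hv, mul_one]

theorem V_mul_U_mul_star_V (α : ℝ) :
    V.{w} α * U α * star (V α) = (Circle.exp (2 * Real.pi * -α) : ℂ) • U α :=
  mul_mul_star_eq_smul (V_unitary α) (U_mul_V α)

/-- Conjugation by `V` is an automorphism sending `U` to `e^{-2πiα} U`, and automorphisms commute
with the functional calculus. -/
theorem V_mul_funOf_mul_star_V (α : ℝ) (h : C(Circle, ℂ)) :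
    V.{w} α * funOf h (U α) * star (V α) = funOf (h.comp (rotMap (-α))) (U α) := by
  have := map_funOf ((Unitary.conjStarAlgAut ℂ (Torus.{w} α)
    ⟨V α, V_unitary α⟩ : Torus.{w} α ≃⋆ₐ[ℂ] Torus.{w} α) : Torus.{w} α →⋆ₐ[ℂ] Torus.{w} α)
    h (U_unitary α)
  refine Eq.trans this ?_
  change funOf h (V α * U α * star (V α)) = _
  rw [V_mul_U_mul_star_V, funOf_smul _ _ (U_unitary α)]
  rfl

theorem V_mul_funOf (α : ℝ) (h : C(Circle, ℂ)) :
    V.{w} α * funOf h (U α) = funOf (h.comp (rotMap (-α))) (U α) * V α := by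
  rw [← V_mul_funOf_mul_star_V, mul_assoc, Unitary.star_mul_self_of_mem (V_unitary α), mul_one]

theorem star_V_mul_funOf (α : ℝ) (h : C(Circle, ℂ)) :
    star (V.{w} α) * funOf h (U α) = funOf (h.comp (rotMap α)) (U α) * star (V α) := by
  have e : (h.comp (rotMap α)).comp (rotMap (-α)) = h := by
    ext z
    simp only [ContinuousMap.comp_apply, rotMap_apply, rot_rot, add_neg_cancel, rot_zero]
  have := V_mul_funOf.{w} α (h.comp (rotMap α))
  rw [e] at this
  calc star (V.{w} α) * funOf h (U α)
      = star (V.{w} α) * (funOf h (U α) * V α) * star (V α) := by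
        rw [mul_assoc, mul_assoc, Unitary.mul_star_self_of_mem (V_unitary α), mul_one]
    _ = _ := by
        rw [← this, ← mul_assoc, Unitary.star_mul_self_of_mem (V_unitary α), one_mul]

/-! ### The skew-product on `C(𝕋) Vⁿ` -/

/-- One recursion covers both signs of `n`, so later arguments need not look at the two product
formulas. -/
theorem cocycle_add_one (α : ℝ) (f : C(Circle, Circle)) (n : ℤ) (z : Circle) :
    cocycle α f (n + 1) z = f z * cocycle α f n (rot (-α) z) := by
  rcases n with n | _ | m
  · change cocycle α f (Int.ofNat (n + 1)) z = _
    rw [cocycle, cocycle, Finset.prod_range_succ', mul_comm]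
    congr 1
    · simp [rot_zero]
    · refine Finset.prod_congr rfl fun l _ => ?_
      rw [rot_rot]
      push_cast
      ring_nf
  · change cocycle α f (Int.ofNat 0) z = _
    simp [cocycle, rot_rot, rot_zero, Complex.mul_conj]
  · change cocycle α f (Int.negSucc m) z = _
    -- At the point `R_{-α} z` the factor `l = 1` is `conj (f z)`, which cancels `f z`; the
    -- remaining indices are then shifted down by one.
    rw [cocycle, cocycle, ← Finset.insert_Icc_add_one_left_eq_Icc (by omega : 1 ≤ m + 1 + 1),
      Finset.prod_insert (by simp), ← mul_assoc, rot_rot]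
    have e : (f z : ℂ) * conj (f (rot (((1 : ℕ) : ℝ) * α + -α) z) : ℂ) = 1 := by
      simp [rot_zero, Complex.mul_conj]
    rw [e, one_mul, ← Finset.image_add_right_Icc, Finset.prod_image (by simp)]
    refine Finset.prod_congr rfl fun l _ => ?_
    rw [rot_rot]
    push_cast
    ring_nf

theorem continuous_cocycle (α : ℝ) (f : C(Circle, Circle)) (n : ℤ) :
    Continuous (cocycle α f n) := by
  have h (a : ℝ) : Continuous fun z => (f (rot a z) : ℂ) :=
    continuous_subtype_val.comp (f.continuous.comp (rotMap a).continuous)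
  rcases n with n | m
  · exact continuous_finsetProd _ fun l _ => h _
  · exact continuous_finsetProd _ fun l _ => Complex.continuous_conj.comp (h _)

/-- The function `f_n` as a continuous map. -/
def cocycleMap (α : ℝ) (f : C(Circle, Circle)) (n : ℤ) : C(Circle, ℂ) :=
  ⟨cocycle α f n, continuous_cocycle α f n⟩

theorem cocycleMap_add_one (α : ℝ) (f : C(Circle, Circle)) (n : ℤ) :
    cocycleMap α f (n + 1) = toComplex f * (cocycleMap α f n).comp (rotMap (-α)) :=
  ContinuousMap.ext fun z => cocycle_add_one α f n z

/-- Both sides equal `1` at `n = 0` and satisfy `x_{n+1} = f(U) V x_n`. As `f(U) V` is unitary, the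
recursion can also be run backwards. -/
theorem anzai_vPow (α θ : ℝ) (f : C(Circle, Circle)) (n : ℤ) :
    anzai.{w} α θ f (vPow α n) = funOf (cocycleMap α f n) (U α) * vPow α n := by
  have step (n : ℤ) : funOf (cocycleMap α f (n + 1)) (U α) * vPow.{w} α (n + 1) =
      funOf (toComplex f) (U α) * V α * (funOf (cocycleMap α f n) (U α) * vPow α n) := by
    rw [cocycleMap_add_one, funOf_mul _ _ (U_unitary α), vPow_add_one, ← mul_assoc,
      mul_assoc _ _ (V α), ← V_mul_funOf]
    simp only [mul_assoc]
  have step' (n : ℤ) : anzai.{w} α θ f (vPow α (n + 1)) =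
      funOf (toComplex f) (U α) * V α * anzai α θ f (vPow α n) := by
    rw [vPow_add_one, map_mul, anzai_V]
  have hu : funOf (toComplex f) (U α) * V α ∈ unitary (Torus.{w} α) :=
    mul_mem (funOf_mem_unitary f (U_unitary α)) (V_unitary α)
  induction n with
  | zero =>
    rw [show cocycleMap α f 0 = 1 from rfl, funOf_one (U_unitary α), vPow_zero, map_one, one_mul]
  | succ n ih => rw [step, step', ih]
  | pred n ih =>
    have h1 := step (-n - 1)
    have h2 := step' (-n - 1)
    rw [sub_add_cancel] at h1 h2
    rw [h1, h2] at ih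
    have := congrArg (star (funOf (toComplex f) (U α) * V α) * ·) ih
    simpa only [← mul_assoc _ (funOf (toComplex f) (U α) * V α),
      Unitary.star_mul_self_of_mem hu, one_mul] using this

theorem anzai_funOf (α θ : ℝ) (f : C(Circle, Circle)) (g : C(Circle, ℂ)) :
    anzai.{w} α θ f (funOf g (U α)) = funOf (g.comp (rotMap (θ / (2 * Real.pi)))) (U α) := by
  have h := map_funOf (skewHom.{w} α θ f) g (U_unitary α)
  rw [skewHom_U, funOf_smul _ _ (U_unitary α)] at h
  have e : 2 * Real.pi * (θ / (2 * Real.pi)) = θ := mul_div_cancel₀ _ (by positivity)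
  rw [rotMap, e]
  exact h

/-- The bridge between dynamics and functions: the factor `Vⁿ` is invertible and `g ↦ g(U)` is
injective, so both can be cancelled. -/
theorem anzai_funOf_mul_vPow_eq_iff (α θ : ℝ) (f : C(Circle, Circle)) (n : ℤ)
    (g : C(Circle, ℂ)) :
    anzai.{w} α θ f (funOf g (U α) * vPow α n) = funOf g (U α) * vPow α n ↔
      SolvesCohomological α θ f n g := by
  rw [map_mul, anzai_vPow, anzai_funOf, ← mul_assoc, ← funOf_mul _ _ (U_unitary α)]
  constructor
  · intro h z
    exact DFunLike.congr_fun (funOf_U_injective α (mul_vPow_cancel h)) z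
  · intro h
    congr 2
    exact ContinuousMap.ext h

/-! ### Vector valued Fourier coefficients -/

section Fourier

theorem integrable_of_continuous {E : Type*} [NormedAddCommGroup E] {T : ℝ}
    [Fact (0 < T)] {f : AddCircle T → E} (hf : Continuous f) :
    MeasureTheory.Integrable f AddCircle.haarAddCircle :=
  hf.integrable_of_hasCompactSupport (HasCompactSupport.of_compactSpace f)

variable {E F : Type*} [NormedAddCommGroup E] [NormedSpace ℂ E] [NormedAddCommGroup F]
  [NormedSpace ℂ F] {T : ℝ} [hT : Fact (0 < T)]

theorem map_fourierCoeff [CompleteSpace E] [CompleteSpace F] (L : E →L[ℂ] F)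
    {f : AddCircle T → E} (hf : Continuous f) (n : ℤ) :
    L (fourierCoeff f n) = fourierCoeff (fun t => L (f t)) n := by
  rw [fourierCoeff, fourierCoeff,
    ← L.integral_comp_comm ((integrable_of_continuous hf).fourier_smul (-n))]
  simp only [map_smul]

theorem fourierCoeff_fourier_smul (f : AddCircle T → E) (k n : ℤ) :
    fourierCoeff (fun t => fourier k t • f t) n = fourierCoeff f (n - k) := by
  rw [fourierCoeff, fourierCoeff]
  congr 1
  ext t
  rw [smul_smul, ← fourier_add, neg_sub, neg_add_eq_sub]

theorem fourierCoeff_const [CompleteSpace E] (x : E) (n : ℤ) :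
    fourierCoeff (fun _ : AddCircle T => x) n = if n = 0 then x else 0 := by
  rw [fourierCoeff]
  split_ifs with h
  · simp [h]
  -- For `n ≠ 0` translation by half a period of the character changes its sign, so its integral
  -- vanishes.
  · rw [integral_smul_const,
      MeasureTheory.integral_eq_zero_of_add_right_eq_neg
        (fourier_add_half_inv_index (neg_ne_zero.2 h) hT.out), zero_smul]

theorem norm_fourierCoeff_le {f : AddCircle T → E} {C : ℝ} (hf : ∀ t, ‖f t‖ ≤ C) (n : ℤ) :
    ‖fourierCoeff f n‖ ≤ C := by
  refine (MeasureTheory.norm_integral_le_of_norm_le_const (C := C)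
    (Filter.Eventually.of_forall fun t => ?_)).trans_eq (by simp)
  rw [norm_smul, fourier_apply, Circle.norm_coe, one_mul]
  exact hf t

/-- Continuous functionals separate points, which reduces to the scalar case. There the vanishing
coefficients are summable, so the Fourier series converges pointwise to the function. -/
theorem eq_zero_of_fourierCoeff_eq_zero [CompleteSpace E] {f : AddCircle T → E}
    (hf : Continuous f) (h : ∀ n, fourierCoeff f n = 0) (t : AddCircle T) : f t = 0 := by
  refine SeparatingDual.eq_zero_of_forall_dual_eq_zero (R := ℂ) fun L => ?_
  let k : C(AddCircle T, ℂ) := ⟨fun t => L (f t), L.continuous.comp hf⟩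
  have hk : fourierCoeff k = 0 := by
    ext n
    exact (map_fourierCoeff L hf n).symm.trans (by rw [h, map_zero, Pi.zero_apply])
  have hs := has_pointwise_sum_fourier_series_of_summable (f := k)
    (by rw [hk]; exact summable_zero) t
  simp only [hk, Pi.zero_apply, zero_smul] at hs
  exact hs.unique hasSum_zero

end Fourier

/-! ### Functions invariant under an irrational rotation -/

/-- The function is constant on the orbit of `1`, which is dense. -/
theorem eq_const_of_rotation_invariant {X : Type*} [TopologicalSpace X] [T2Space X] {θ : ℝ}
    (hθ : Irrational (θ / (2 * Real.pi))) {g : Circle → X} (hg : Continuous g)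
    (h : ∀ z, g (Circle.exp θ * z) = g z) (z : Circle) : g z = g 1 := by
  have hd := AddCircle.denseRange_zsmul_coe_iff.2 hθ
  have hz (n : ℤ) : g (Circle.exp θ ^ n) = g 1 := by
    induction n with
    | zero => rw [zpow_zero]
    | succ n ih => rw [zpow_add_one, mul_comm, h, ih]
    | pred n ih => rw [← ih, ← h, ← zpow_one_add, add_sub_cancel]
  have := DenseRange.equalizer hd (g := fun t : AddCircle (2 * Real.pi) => g t.toCircle)
    (h := fun _ => g 1) (hg.comp AddCircle.continuous_toCircle) continuous_const (funext fun n => by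
      change g (AddCircle.toCircle (T := 2 * Real.pi) (n • (θ : AddCircle (2 * Real.pi)))) = g 1
      rw [AddCircle.toCircle_zsmul, AddCircle.toCircle_apply_mk, div_self (by positivity), one_mul, hz])
  obtain ⟨t, rfl⟩ := (AddCircle.homeomorphCircle (T := 2 * Real.pi) (by positivity)).surjective z
  rw [AddCircle.homeomorphCircle_apply]
  exact congrFun this t

/-! ### The gauge action -/

theorem one_smul_eq {B : Type*} [CStarAlgebra B] (x : B) : (1 : ℂ) • x = x := one_smul ℂ x


/-- The gauge action of the circle, which fixes `U` and multiplies `V` by a scalar. -/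
def gauge (α : ℝ) (t : AddCircle (1 : ℝ)) : Torus.{w} α →⋆ₐ[ℂ] Torus.{w} α :=
  skewHom α 0 (ContinuousMap.const Circle t.toCircle)

theorem gauge_U (α : ℝ) (t : AddCircle (1 : ℝ)) : gauge.{w} α t (U α) = U α := by
  rw [gauge, skewHom_U, Circle.exp_zero]
  exact one_smul_eq _

theorem gauge_funOf (α : ℝ) (t : AddCircle (1 : ℝ)) (h : C(Circle, ℂ)) :
    gauge.{w} α t (funOf h (U α)) = funOf h (U α) := by
  rw [map_funOf _ _ (U_unitary α), gauge_U]

/-- The gauge action is the skew-product with `θ = 0` and constant `f`, so this turns `anzai_vPow`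
into the statement that `Vⁿ` has degree `n`. -/
theorem cocycleMap_const (α : ℝ) (t : AddCircle (1 : ℝ)) (n : ℤ) :
    cocycleMap α (ContinuousMap.const Circle t.toCircle) n =
      ContinuousMap.const Circle (fourier n t) := by
  ext z
  rw [ContinuousMap.const_apply, fourier_apply, AddCircle.toCircle_zsmul]
  rcases n with n | m
  · change ∏ l ∈ Finset.range n, (t.toCircle : ℂ) = _
    simp
  · change ∏ l ∈ Finset.Icc 1 (m + 1), conj (t.toCircle : ℂ) = _
    simp [zpow_negSucc, ← Circle.coe_inv_eq_conj]

theorem gauge_vPow (α : ℝ) (t : AddCircle (1 : ℝ)) (n : ℤ) :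
    gauge.{w} α t (vPow α n) = fourier n t • vPow α n := by
  refine (anzai_vPow α 0 (ContinuousMap.const Circle t.toCircle) n).trans ?_
  rw [cocycleMap_const, funOf_const _ (U_unitary α)]
  exact smul_one_mul _ _

theorem gauge_V (α : ℝ) (t : AddCircle (1 : ℝ)) :
    gauge.{w} α t (V α) = fourier 1 t • V α := by
  have h := gauge_vPow.{w} α t 1
  rwa [← zero_add (1 : ℤ), vPow_add_one, vPow_zero, mul_one] at h

theorem gauge_star_V (α : ℝ) (t : AddCircle (1 : ℝ)) :
    gauge.{w} α t (star (V α)) = fourier (-1) t • star (V α) := by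
  rw [map_star, gauge_V, star_smul, fourier_neg]
  rfl

/-- Each `φ t` is a contraction, so approximating `a` approximates its orbit map uniformly in `t`,
and uniform limits of continuous maps are continuous. -/
theorem isClosed_setOf_continuous_apply {X A B : Type*} [TopologicalSpace X] [SeminormedAddCommGroup A]
    [SeminormedAddCommGroup B] (φ : X → A →+ B) (hφ : ∀ t a, ‖φ t a‖ ≤ ‖a‖) :
    IsClosed {a | Continuous fun t => φ t a} := by
  refine isClosed_of_closure_subset fun a ha => ?_
  refine continuous_of_uniform_approx_of_continuous fun s hs => ?_
  obtain ⟨ε, hε, h⟩ := Metric.mem_uniformity_dist.1 hs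
  obtain ⟨b, hb, hab⟩ := Metric.mem_closure_iff.1 ha ε hε
  refine ⟨_, hb, fun t => h ?_⟩
  rw [dist_eq_norm, ← map_sub]
  exact (hφ t _).trans_lt (by rwa [← dist_eq_norm])

theorem continuous_gauge_apply (α : ℝ) (a : Torus.{w} α) :
    Continuous fun t => gauge α t a := by
  let K : StarSubalgebra ℂ (Torus.{w} α) :=
    { carrier := {a | Continuous fun t => gauge α t a}
      mul_mem' := fun {x y} hx hy => by
        simp only [Set.mem_ofPred_eq, map_mul]
        exact hx.mul hy
      add_mem' := fun {x y} hx hy => by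
        simp only [Set.mem_ofPred_eq, map_add]
        exact hx.add hy
      algebraMap_mem' := fun c => by
        simp only [Set.mem_ofPred_eq, AlgHomClass.commutes]
        exact continuous_const
      star_mem' := fun {x} hx => by
        simp only [Set.mem_ofPred_eq, map_star]
        exact hx.star }
  have hK : IsClosed (K : Set (Torus.{w} α)) :=
    isClosed_setOf_continuous_apply (fun t => (gauge α t : Torus.{w} α →+ Torus.{w} α))
      fun t a => NonUnitalStarAlgHom.norm_apply_le (gauge α t) a
  have ha : a ∈ K := by
    rw [eq_top_of_isClosed hK]
    · trivial
    · change Continuous fun t => gauge α t (U α)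
      simp only [gauge_U]
      exact continuous_const
    · change Continuous fun t => gauge α t (V α)
      simp only [gauge_V]
      exact (fourier 1).continuous.smul continuous_const
  exact ha

/-! ### Fourier coefficients in the noncommutative torus -/

/-- The `n`-th spectral component `∫ t⁻ⁿ γ_t(a) dt` of `a` for the gauge action. -/
def component (α : ℝ) (n : ℤ) : Torus.{w} α →L[ℂ] Torus.{w} α :=
  LinearMap.mkContinuous
    { toFun := fun a => fourierCoeff (fun t => gauge α t a) n
      map_add' := fun a b => by
        simp only [map_add]
        exact congrFun (fourierCoeff.add (integrable_of_continuous (continuous_gauge_apply α a))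
          (integrable_of_continuous (continuous_gauge_apply α b))) n
      map_smul' := fun c a => by
        simp only [map_smul]
        exact fourierCoeff.const_smul _ c n } 1 fun a => by
    rw [one_mul]
    exact norm_fourierCoeff_le (fun t => NonUnitalStarAlgHom.norm_apply_le (gauge α t) a) n

theorem component_apply (α : ℝ) (n : ℤ) (a : Torus.{w} α) :
    component α n a = fourierCoeff (fun t => gauge α t a) n := rfl

/-- By uniqueness of Fourier coefficients the whole orbit map vanishes; at `t = 0` it takes the
value `a`. -/
theorem eq_zero_of_component_eq_zero {α : ℝ} {a : Torus.{w} α}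
    (h : ∀ n, component α n a = 0) : a = 0 := by
  have := eq_zero_of_fourierCoeff_eq_zero (continuous_gauge_apply α a) h 0
  have e : gauge.{w} α 0 = StarAlgHom.id ℂ (Torus.{w} α) := by
    refine hom_ext (gauge_U α 0) ?_
    rw [gauge_V, fourier_eval_zero]
    exact one_smul_eq _
  rwa [e] at this

theorem component_funOf_mul_vPow (α : ℝ) (h : C(Circle, ℂ)) (k n : ℤ) :
    component.{w} α n (funOf h (U α) * vPow α k) =
      if n = k then funOf h (U α) * vPow α k else 0 := by
  have e (t : AddCircle (1 : ℝ)) : gauge.{w} α t (funOf h (U α) * vPow α k) =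
      fourier k t • (funOf h (U α) * vPow α k) := by
    rw [map_mul, gauge_funOf, gauge_vPow]
    exact mul_smul_comm _ _ _
  simp only [component_apply, e]
  rw [fourierCoeff_fourier_smul, fourierCoeff_const]
  simp only [sub_eq_zero]

theorem component_smul_one (α : ℝ) (c : ℂ) (n : ℤ) :
    component.{w} α n (c • 1) = if n = 0 then c • 1 else 0 := by
  have h := component_funOf_mul_vPow.{w} α (ContinuousMap.const Circle c) 0 n
  rwa [vPow_zero, mul_one, funOf_const _ (U_unitary α)] at h

/-- An `x` homogeneous of degree `k` shifts degrees by `k`, and left multiplication by `x` is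
bounded, so it passes through the integral. -/
theorem component_mul {α : ℝ} {x : Torus.{w} α} {k : ℤ}
    (hx : ∀ t, gauge α t x = fourier k t • x) (n : ℤ) (a : Torus.{w} α) :
    component α n (x * a) = x * component α (n - k) a := by
  have e (t : AddCircle (1 : ℝ)) : gauge α t (x * a) = fourier k t • (x * gauge α t a) := by
    rw [map_mul, hx]
    exact smul_mul_assoc _ _ _
  simp only [component_apply, e]
  rw [fourierCoeff_fourier_smul]
  exact (map_fourierCoeff (ContinuousLinearMap.mul ℂ (Torus.{w} α) x)
    (continuous_gauge_apply α a) (n - k)).symm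

theorem component_mul_of_fixed {α : ℝ} {x : Torus.{w} α}
    (hx : ∀ t, gauge α t x = x) (n : ℤ) (a : Torus.{w} α) :
    component α n (x * a) = x * component α n a := by
  have := component_mul (k := 0) (x := x)
    (fun t => by rw [hx, fourier_zero]; exact (one_smul_eq x).symm) n a
  rwa [sub_zero] at this

/-- The skew-product preserves degrees: the images of `U` and `V` again have degrees `0` and `1`.
Checking the generators is enough. -/
theorem anzai_gauge (α θ : ℝ) (f : C(Circle, Circle)) (t : AddCircle (1 : ℝ))
    (a : Torus.{w} α) : anzai α θ f (gauge α t a) = gauge α t (anzai α θ f a) := by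
  have e : (skewHom.{w} α θ f).comp (gauge α t) = (gauge α t).comp (skewHom α θ f) := by
    refine hom_ext ?_ ?_
    · change skewHom.{w} α θ f (gauge α t (U α)) = gauge α t (skewHom α θ f (U α))
      rw [gauge_U, skewHom_U, map_smul, gauge_U]
    · change skewHom.{w} α θ f (gauge α t (V α)) = gauge α t (skewHom α θ f (V α))
      rw [gauge_V, skewHom_V, map_smul, map_mul, gauge_funOf, gauge_V, skewHom_V]
      exact (mul_smul_comm _ _ _).symm
  exact DFunLike.congr_fun e a

theorem anzai_component (α θ : ℝ) (f : C(Circle, Circle)) (n : ℤ) (a : Torus.{w} α) :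
    anzai α θ f (component α n a) = component α n (anzai α θ f a) := by
  have := map_fourierCoeff (⟨(skewHom.{w} α θ f).toAlgHom.toLinearMap,
    continuous_hom (skewHom.{w} α θ f)⟩ : Torus.{w} α →L[ℂ] Torus.{w} α) (continuous_gauge_apply α a) n
  refine Eq.trans this ?_
  rw [component_apply]
  congr 1
  ext1 t
  exact anzai_gauge α θ f t a

/-- The elements whose components of every degree `n` lie in `C(𝕋) Vⁿ` form a closed subspace
containing `1`. It is stable under left multiplication by the generators and their adjoints, because
conjugation by `V` preserves the functions of `U`. -/
theorem component_mul_vPow_neg_mem (α : ℝ) (a : Torus.{w} α) (n : ℤ) :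
    component α n a * vPow α (-n) ∈ functionsOf (U_unitary.{w} α) := by
  let S := functionsOf (U_unitary.{w} α)
  let M : Submodule ℂ (Torus.{w} α) := ⨅ n : ℤ, S.toSubalgebra.toSubmodule.comap
    (((ContinuousLinearMap.mul ℂ (Torus.{w} α)).flip (vPow α (-n)) ∘L component α n :
      Torus.{w} α →L[ℂ] Torus.{w} α) : Torus.{w} α →ₗ[ℂ] Torus.{w} α)
  have hM (b : Torus.{w} α) : b ∈ M ↔ ∀ n, component α n b * vPow α (-n) ∈ S :=
    Submodule.mem_iInf _
  have hconj (x : Torus.{w} α) (hx : x ∈ S) : V α * x * star (V α) ∈ S := by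
    obtain ⟨h, rfl⟩ := exists_eq_funOf (U_unitary α) (mem_spectrum_U α) hx
    rw [V_mul_funOf_mul_star_V]
    exact funOf_mem_functionsOf _ _
  have hconj' (x : Torus.{w} α) (hx : x ∈ S) : star (V α) * x * V α ∈ S := by
    obtain ⟨h, rfl⟩ := exists_eq_funOf (U_unitary α) (mem_spectrum_U α) hx
    rw [star_V_mul_funOf, mul_assoc, Unitary.star_mul_self_of_mem (V_unitary α), mul_one]
    exact funOf_mem_functionsOf _ _
  refine (hM a).1 (mem_of_mul_left_stable ?_ ?_ ?_ ?_ ?_ ?_ a) n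
  · have : (M : Set (Torus.{w} α)) =
        ⋂ n : ℤ, (fun b => component α n b * vPow α (-n)) ⁻¹' (S : Set (Torus.{w} α)) := by
      ext b
      rw [Set.mem_iInter]
      exact hM b
    rw [this]
    exact isClosed_iInter fun n => (isClosed_functionsOf (U_unitary.{w} α)).preimage
      ((component α n).continuous.mul continuous_const)
  · refine (hM _).2 fun n => ?_
    rw [← one_smul_eq (1 : Torus.{w} α), component_smul_one]
    split_ifs with h
    · rw [h, neg_zero, vPow_zero, mul_one, one_smul_eq]
      exact one_mem S
    · rw [zero_mul]
      exact zero_mem S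
  · intro b hb
    refine (hM _).2 fun n => ?_
    rw [component_mul_of_fixed (gauge_U α), mul_assoc]
    exact mul_mem (self_mem_functionsOf _) ((hM b).1 hb n)
  · intro b hb
    refine (hM _).2 fun n => ?_
    rw [component_mul_of_fixed (fun t => by rw [map_star, gauge_U]), mul_assoc]
    exact mul_mem (star_mem (self_mem_functionsOf _)) ((hM b).1 hb n)
  · intro b hb
    refine (hM _).2 fun n => ?_
    -- Degree `n` of `V b` is `V` times degree `n - 1` of `b`; the extra `star V` from the
    -- conjugation completes `V^{-(n-1)}` to `V^{-n}`.
    have := hconj _ ((hM b).1 hb (n - 1))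
    rw [component_mul (gauge_V α)]
    rwa [mul_assoc, mul_assoc, ← vPow_sub_one, ← mul_assoc, neg_sub, sub_sub_cancel_left] at this
  · intro b hb
    refine (hM _).2 fun n => ?_
    have := hconj' _ ((hM b).1 hb (n + 1))
    rw [component_mul (gauge_star_V α), sub_neg_eq_add]
    rwa [mul_assoc, mul_assoc, ← vPow_add_one', ← mul_assoc, neg_add_rev,
      neg_add_cancel_comm] at this

theorem exists_component_eq (α : ℝ) (a : Torus.{w} α) (n : ℤ) :
    ∃ g : C(Circle, ℂ), component α n a = funOf g (U α) * vPow α n := by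
  obtain ⟨g, hg⟩ := exists_eq_funOf (U_unitary α) (mem_spectrum_U α)
    (component_mul_vPow_neg_mem α a n)
  refine ⟨g, ?_⟩
  have h := vPow_mul_vPow_neg.{w} α (-n)
  rw [neg_neg] at h
  rw [← hg, mul_assoc, h, mul_one]

end NCTorus

end

/-! ### The ergodicity criterion -/

theorem mainTheorem5 (α θ : ℝ) (hθ : Irrational (θ / (2 * Real.pi))) (f : C(Circle, Circle)) :
    NCTorus.TopologicallyErgodic (NCTorus.anzai.{w} α θ f) ↔
      ∀ n : ℤ, n ≠ 0 →
        ¬ ∃ g : C(Circle, ℂ), g ≠ 0 ∧ NCTorus.SolvesCohomological α θ f n g := by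
  open NCTorus in
  constructor
  · rintro h n hn ⟨g, hg, hs⟩
    have hfix : funOf g (U α) * vPow.{w} α n ∈ (fixedPoints (anzai.{w} α θ f) : Set (Torus.{w} α)) :=
      (anzai_funOf_mul_vPow_eq_iff α θ f n g).2 hs
    rw [h] at hfix
    obtain ⟨c, hc⟩ := hfix
    -- The fixed element equals its own degree `n` component, while a scalar has none for `n ≠ 0`;
    -- hence `g(U) Vⁿ = 0`.
    have h1 := component_funOf_mul_vPow.{w} α g n n
    rw [hc, component_smul_one, if_neg hn, if_pos rfl, ← hc,
      ← zero_mul (vPow.{w} α n)] at h1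
    refine hg (funOf_U_injective.{w} α ?_)
    change funOf g (U α) = funOf (ContinuousMap.const Circle 0) (U α)
    rw [funOf_const _ (U_unitary α), zero_smul]
    exact (mul_vPow_cancel h1).symm
  · intro h
    refine Set.Subset.antisymm (fun a ha => ?_) ?_
    · have hcomp (n : ℤ) : ∃ g : C(Circle, ℂ), component α n a = funOf g (U α) * vPow α n ∧
          SolvesCohomological α θ f n g := by
        obtain ⟨g, hg⟩ := exists_component_eq α a n
        refine ⟨g, hg, (anzai_funOf_mul_vPow_eq_iff.{w} α θ f n g).1 ?_⟩
        rw [← hg, anzai_component, show anzai α θ f a = a from ha]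
      obtain ⟨g, hg, hs⟩ := hcomp 0
      -- In degree `0` the equation says that `g` is invariant under the rotation by `θ`;
      -- irrationality enters here.
      have hconst : g = ContinuousMap.const Circle (g 1) := by
        ext z
        refine eq_const_of_rotation_invariant hθ g.continuous (fun z => ?_) z
        have := hs z
        rw [rot, mul_div_cancel₀ _ (by positivity)] at this
        simpa [cocycle] using this
      rw [hconst, funOf_const _ (U_unitary α), vPow_zero, mul_one] at hg
      -- The scalar is the constant value of the degree `0` function; all components of the
      -- difference are then zero.
      refine ⟨g 1, sub_eq_zero.1 (eq_zero_of_component_eq_zero fun n => ?_)⟩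
      rw [map_sub, component_smul_one]
      split_ifs with hn
      · rw [hn, hg, sub_self]
      · obtain ⟨k, hk, hks⟩ := hcomp n
        have hk0 : k = ContinuousMap.const Circle 0 := by
          by_contra hne
          exact h n hn ⟨k, hne, hks⟩
        rw [hk, hk0, funOf_const _ (U_unitary α), zero_smul, zero_mul, sub_zero]
    · rintro _ ⟨c, rfl⟩
      exact SMulMemClass.smul_mem c (one_mem (fixedPoints (anzai.{w} α θ f)))
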